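/- Consider the system $\dot x = Ax+Bu$, $y=\tfrac12 x^\top Cx$ with $x\in\mathbb{R}^n$, $u\in\mathbb{R}^p$, constant matrices $A\in\mathbb{R}^{n\times n}$, $B\in\mathbb{R}^{n\times p}$ and a symmetric matrix $C\in\mathbb{R}^{n\times n}$. Define $C_0=C$ and $C_{i+1}=C_iA+A^\top C_i$ for $i\ge 0$, and let $m\in\mathbb{N}$ be such that $C_m=0$. For $v\in\mathbb{R}^p$ let $$\mathcal{A}(v)=\begin{bmatrix}S_m & U(v)\\ 0 & A\end{bmatrix}\in\mathbb{R}^{(m+n)\times(m+n)},\qquad \mathcal{C}=\begin{bmatrix}1&0&\cdots&0&0_{1\times n}\end{bmatrix}\in\mathbb{R}^{1\times(m+n)},$$ where $S_m\in\mathbb{R}^{m\times m}$ is the shift matrix (ones on the first superdiagonal, zeros elsewhere) and $U(v)\in\mathbb{R}^{m\times n}$ has the rows $v^\top B^\top C_i$, $i=0,\dots,m-1$. Let the input $u:[0,\infty)\to\mathbb{R}^p$ be $m$ times differentiable with $u,\dot u,\dots,u^{(m)}$ bounded on $[0,\infty)$, and define the row vectors $r_0=0$, $r_{i+1}(t)=r_i(t)A+\dot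 r_i(t)+u(t)^\top B^\top C_i$. Write $\Phi_{22}(s,t)=\exp(A(s-t))$. Suppose that there are $\bar\delta>0$ and $\bar\mu>0$ such that for all $t\ge 0$ $$\int_t^{t+\bar\delta}\Phi_{22}(s,t)^\top r_m(s)^\top r_m(s)\,\Phi_{22}(s,t)\,ds\ \ge\ \bar\mu I_n .$$ Then the pair $(\mathcal{A}(u(t)),\mathcal{C})$ is uniformly observable: there are $\delta>0$ and $\mu>0$ such that for all $t\ge 0$ $$\int_t^{t+\delta}\Phi(s,t)^\top\mathcal{C}^\top\mathcal{C}\,\Phi(s,t)\,ds\ \ge\ \mu I_{m+n},$$ where $\Phi$ is the transition matrix of $\dot z=\mathcal{A}(u(t))z$ on $[0,\infty)$, i.e. $\frac{d}{dt}\Phi(t,\tau)=\mathcal{A}(u(t))\Phi(t,\tau)$, $\Phi(\tau,\tau)=I_{m+n}$. (Inequalities between symmetric matrices are in the positive semidefinite order.) -/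

import Mathlib

open Set Matrix

noncomputable section

/-! Linear time-varying systems on `[0, ∞)`. -/

/-- `Φ` is the state-transition matrix of `ẋ = A(t) x` on `[0, ∞)`:
`d/dt Φ(t, τ) = A(t) Φ(t, τ)` and `Φ(τ, τ) = I` for all `t, τ ≥ 0`
(the derivative is entrywise, and one-sided at `t = 0`). -/
def IsTransitionMatrix {ι : Type*} [Fintype ι] [DecidableEq ι]
    (A : ℝ → Matrix ι ι ℝ) (Φ : ℝ → ℝ → Matrix ι ι ℝ) : Prop :=
  ∀ τ : ℝ, 0 ≤ τ → Φ τ τ = 1 ∧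
    ∀ t : ℝ, 0 ≤ t → ∀ i j : ι,
      HasDerivWithinAt (fun s => Φ s τ i j) ((A t * Φ t τ) i j) (Ici 0) t

/-- The transition matrix is unique, so that it does not matter which one is used below. -/
theorem IsTransitionMatrix.eq_of_le {ι : Type*} [Fintype ι] [DecidableEq ι]
    {A : ℝ → Matrix ι ι ℝ} {Φ Ψ : ℝ → ℝ → Matrix ι ι ℝ}
    (hA : ContinuousOn A (Ici 0)) (hΦ : IsTransitionMatrix A Φ) (hΨ : IsTransitionMatrix A Ψ)
    {τ t : ℝ} (hτ : 0 ≤ τ) (ht : τ ≤ t) : Φ t τ = Ψ t τ := by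
  let _ : NormedAddCommGroup (Matrix ι ι ℝ) := Matrix.linftyOpNormedAddCommGroup
  obtain ⟨M, hM⟩ := isCompact_Icc.exists_bound_of_continuousOn
    (hA.mono (fun s (hs : s ∈ Icc τ t) => hτ.trans hs.1))
  have key : ∀ (X : ℝ → ℝ → Matrix ι ι ℝ), IsTransitionMatrix A X → ∀ j : ι,
      ∀ s : ℝ, 0 ≤ s →
        HasDerivWithinAt (fun r => fun i => X r τ i j) (A s *ᵥ fun i => X s τ i j) (Ici 0) s := by
    intro X hX j s hs
    rw [hasDerivWithinAt_pi]
    intro i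
    exact (hX τ hτ).2 s hs i j
  ext i j
  have h := ODE_solution_unique_of_mem_Icc_right (v := fun s x => A s *ᵥ x) (s := fun _ => univ)
    (K := M.toNNReal) (a := τ) (b := t)
    (f := fun r => fun i => Φ r τ i j) (g := fun r => fun i => Ψ r τ i j)
    (fun s hs => by
      refine (LipschitzWith.of_dist_le_mul fun x y => ?_).lipschitzOnWith
      rw [dist_eq_norm, dist_eq_norm, ← Matrix.mulVec_sub]
      refine (Matrix.linfty_opNorm_mulVec _ _).trans ?_
      gcongr
      exact (hM s ⟨hs.1, hs.2.le⟩).trans (Real.le_coe_toNNReal M))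
    (fun s hs => ((key Φ hΦ j s (hτ.trans hs.1)).continuousWithinAt).mono
      fun r hr => hτ.trans hr.1)
    (fun s hs => (key Φ hΦ j s (hτ.trans hs.1)).mono fun r hr => (hτ.trans hs.1).trans hr)
    (fun _ _ => mem_univ _)
    (fun s hs => ((key Ψ hΨ j s (hτ.trans hs.1)).continuousWithinAt).mono
      fun r hr => hτ.trans hr.1)
    (fun s hs => (key Ψ hΨ j s (hτ.trans hs.1)).mono fun r hr => (hτ.trans hs.1).trans hr)
    (fun _ _ => mem_univ _)
    (by simp [(hΦ τ hτ).1, (hΨ τ hτ).1])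
  exact congrFun (h ⟨ht, le_refl t⟩) i

/-- Entrywise integral of a matrix-valued function. -/
def matrixIntegral {ι κ : Type*} (F : ℝ → Matrix ι κ ℝ) (a b : ℝ) : Matrix ι κ ℝ :=
  Matrix.of fun i j => ∫ s in a..b, F s i j

/-- The observability Gramian
`W(t₀, T) = ∫_{t₀}^{T} Φ(s, t₀)ᵀ C(s)ᵀ C(s) Φ(s, t₀) ds`. -/
def observabilityGramian {ι κ : Type*} [Fintype ι] [Fintype κ]
    (C : ℝ → Matrix κ ι ℝ) (Φ : ℝ → ℝ → Matrix ι ι ℝ) (t₀ T : ℝ) : Matrix ι ι ℝ :=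
  matrixIntegral (fun s => (Φ s t₀)ᵀ * (C s)ᵀ * C s * Φ s t₀) t₀ T

/-- The pair `(A(t), C(t))` is uniformly observable: there are `δ, μ > 0` with
`W(t, t + δ) ≥ μ I` for all `t ≥ 0`, where `W` is the observability Gramian formed with the
transition matrix of `A`. -/
def UniformlyObservable {ι κ : Type*} [Fintype ι] [DecidableEq ι] [Fintype κ]
    (A : ℝ → Matrix ι ι ℝ) (C : ℝ → Matrix κ ι ℝ) : Prop :=
  ∃ Φ : ℝ → ℝ → Matrix ι ι ℝ, IsTransitionMatrix A Φ ∧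
    ∃ δ : ℝ, 0 < δ ∧ ∃ μ : ℝ, 0 < μ ∧ ∀ t : ℝ, 0 ≤ t →
      (observabilityGramian C Φ t (t + δ) - μ • (1 : Matrix ι ι ℝ)).PosSemidef

/-! The augmented system of `ẋ = A x + B u`, `y = ½ xᵀ C x`. -/

/-- `C₀ = C`, `C_{i+1} = C_i A + Aᵀ C_i`. -/
def lieMatrix {n : ℕ} (A C : Matrix (Fin n) (Fin n) ℝ) : ℕ → Matrix (Fin n) (Fin n) ℝ
  | 0 => C
  | i + 1 => lieMatrix A C i * A + Aᵀ * lieMatrix A C i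

/-- The `m × m` shift matrix, with ones on the first superdiagonal. -/
def shiftMatrix (m : ℕ) : Matrix (Fin m) (Fin m) ℝ :=
  Matrix.of fun i j => if (i : ℕ) + 1 = (j : ℕ) then 1 else 0

/-- The `m × n` matrix with rows `vᵀ Bᵀ C_i`, `i = 0, …, m - 1`. -/
def inputBlock {n p : ℕ} (m : ℕ) (A : Matrix (Fin n) (Fin n) ℝ) (B : Matrix (Fin n) (Fin p) ℝ)
    (C : Matrix (Fin n) (Fin n) ℝ) (v : Fin p → ℝ) : Matrix (Fin m) (Fin n) ℝ :=
  Matrix.of fun i => v ᵥ* (Bᵀ * lieMatrix A C i)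

/-- The state matrix `𝒜(v)` of the augmented system, at the input value `v`; the augmented state
is `(z₀, …, z_{m-1}, x)`. -/
def augmentedA {n p : ℕ} (m : ℕ) (A : Matrix (Fin n) (Fin n) ℝ) (B : Matrix (Fin n) (Fin p) ℝ)
    (C : Matrix (Fin n) (Fin n) ℝ) (v : Fin p → ℝ) : Matrix (Fin m ⊕ Fin n) (Fin m ⊕ Fin n) ℝ :=
  Matrix.fromBlocks (shiftMatrix m) (inputBlock m A B C v) 0 A

/-- The output matrix `𝒞 = [1 0 ⋯ 0 | 0]` of the augmented system. -/
def augmentedC (m n : ℕ) : Matrix (Fin 1) (Fin m ⊕ Fin n) ℝ :=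
  Matrix.of fun _ => Sum.elim (fun i => if (i : ℕ) = 0 then 1 else 0) (fun _ => 0)

/-- The row vectors `r₀ = 0`, `r_{i+1}(t) = r_i(t) A + ṙ_i(t) + u(t)ᵀ Bᵀ C_i`, for `t ≥ 0`
(time derivatives are taken on `[0, ∞)`). -/
def rVec {n p : ℕ} (A : Matrix (Fin n) (Fin n) ℝ) (B : Matrix (Fin n) (Fin p) ℝ)
    (C : Matrix (Fin n) (Fin n) ℝ) (u : ℝ → Fin p → ℝ) : ℕ → ℝ → Fin n → ℝ
  | 0 => fun _ => 0
  | i + 1 => fun t =>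
      rVec A B C u i t ᵥ* A + derivWithin (rVec A B C u i) (Ici 0) t
        + u t ᵥ* (Bᵀ * lieMatrix A C i)

/-- The input `u : [0, ∞) → ℝᵖ` is `κ` times differentiable, and `u, u̇, …, u^{(κ)}` are bounded
on `[0, ∞)`. -/
def BoundedInput {p : ℕ} (κ : ℕ) (u : ℝ → Fin p → ℝ) : Prop :=
  (∀ k < κ, DifferentiableOn ℝ (iteratedDerivWithin k u (Ici 0)) (Ici 0)) ∧
    ∀ k ≤ κ, ∃ M : ℝ, ∀ t : ℝ, 0 ≤ t → ‖iteratedDerivWithin k u (Ici 0) t‖ ≤ M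

/-- The pair `(A, r(t))` is persistently exciting: there are `δ, μ > 0` such that
`∫_t^{t+δ} Φ₂₂(s, t)ᵀ r(s)ᵀ r(s) Φ₂₂(s, t) ds ≥ μ I` for all `t ≥ 0`, where
`Φ₂₂(s, t) = exp (A (s - t))` and `r(s)` is a row vector. -/
def PersistentlyExciting {n : ℕ} (A : Matrix (Fin n) (Fin n) ℝ) (r : ℝ → Fin n → ℝ) : Prop :=
  ∃ δ : ℝ, 0 < δ ∧ ∃ μ : ℝ, 0 < μ ∧ ∀ t : ℝ, 0 ≤ t →
    (matrixIntegral (fun s => (NormedSpace.exp ((s - t) • A))ᵀ * Matrix.vecMulVec (r s) (r s) *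
        NormedSpace.exp ((s - t) • A)) t (t + δ)
      - μ • (1 : Matrix (Fin n) (Fin n) ℝ)).PosSemidef

end

/-! Along a solution `(z, x)` of the augmented system put `Y_k = z_k + r_k x`, with `z_k` read as
`0` for `k ≥ m`. Then `Y_0` is the output, and the recursion for `r_k` makes `Y_{k+1}` the
derivative of `Y_k` (`hasDerivWithinAt_outputDeriv`). Since `C_m = 0`, the chain continues through
`k = m`, with `Y_m = r_m x` and `Y_{m+1} = r_{m+1} x`. The latter is bounded on a window of length
`δ` by a multiple of the initial state.

Interpolation (`exists_abs_le_sqrt_integral_sq_add`) therefore bounds `Y_0, …, Y_m` on the window by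
`K ‖Y_0‖_{L²} + ε |state|`, for any `ε > 0`. Conversely, persistent excitation recovers the initial
`x` from `Y_m`, and then `z_k = Y_k - r_k x`; so `|state| ≤ D max_k sup |Y_k|`. Choosing `ε D = 1/2`
absorbs the error term and leaves `|state| ≤ 2 D K ‖Y_0‖_{L²}`, which is the Gramian bound. -/

/-! ### Interpolation estimates for chains of derivatives -/

/-- Descending induction on the order, by the mean value inequality from the left end point. The
index `i` and the scale `N i` keep the constants uniform over a family of trajectories. -/
theorem exists_bound_of_hasDerivWithinAt_chain {ι : Type*} {m : ℕ} {δ : ℝ} (hδ : 0 ≤ δ)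
    {a N : ι → ℝ} {Y : ℕ → ι → ℝ → ℝ}
    (hN : ∀ i, 0 ≤ N i)
    (hY : ∀ k ≤ m, ∀ i, ∀ s ∈ Icc (a i) (a i + δ),
      HasDerivWithinAt (Y k i) (Y (k + 1) i s) (Icc (a i) (a i + δ)) s)
    (h0 : ∀ k ≤ m, ∃ K, ∀ i, |Y k i (a i)| ≤ K * N i)
    (htop : ∃ K, ∀ i, ∀ s ∈ Icc (a i) (a i + δ), |Y (m + 1) i s| ≤ K * N i) :
    ∀ k ≤ m + 1, ∃ K, ∀ i, ∀ s ∈ Icc (a i) (a i + δ), |Y k i s| ≤ K * N i := by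
  intro k hk
  induction hk using Nat.decreasingInduction with
  | self => exact htop
  | of_succ k hk ih =>
    obtain ⟨K, hK⟩ := ih
    obtain ⟨K₀, hK₀⟩ := h0 k (by omega)
    refine ⟨K₀ + |K| * δ, fun i s hs => ?_⟩
    have ha : a i ∈ Icc (a i) (a i + δ) := ⟨le_rfl, by linarith⟩
    have hK' : ∀ x ∈ Icc (a i) (a i + δ), ‖Y (k + 1) i x‖ ≤ |K| * N i := fun x hx =>
      (hK i x hx).trans (mul_le_mul_of_nonneg_right (le_abs_self K) (hN i))
    have h := (convex_Icc (a i) (a i + δ)).norm_image_sub_le_of_norm_hasDerivWithin_le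
      (hY k (by omega) i) hK' ha hs
    have h1 : ‖s - a i‖ ≤ δ := by
      rw [Real.norm_eq_abs, abs_of_nonneg (by linarith [hs.1])]; linarith [hs.2]
    have h2 : |K| * N i * ‖s - a i‖ ≤ |K| * N i * δ :=
      mul_le_mul_of_nonneg_left h1 (mul_nonneg (abs_nonneg K) (hN i))
    have h3 : |Y k i s| ≤ |Y k i (a i)| + |Y k i s - Y k i (a i)| := by
      have := abs_add_le (Y k i (a i)) (Y k i s - Y k i (a i))
      rwa [add_sub_cancel] at this
    rw [Real.norm_eq_abs] at h
    linarith [hK₀ i, h3, h, h2]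

/-- Every point of an interval of length `δ` lies in a closed subinterval of given shorter length
having it as an end point. -/
theorem exists_Icc_subset_of_mem_Icc {a δ h s : ℝ} (hh : 0 < h) (hhδ : h ≤ δ / 2)
    (hs : s ∈ Icc a (a + δ)) :
    ∃ b, Icc b (b + h) ⊆ Icc a (a + δ) ∧ s ∈ Icc b (b + h) := by
  rcases le_total s (a + δ / 2) with h1 | h1
  · exact ⟨s, Icc_subset_Icc hs.1 (by linarith), le_rfl, by linarith⟩
  · exact ⟨s - h, Icc_subset_Icc (by linarith) (by linarith [hs.2]), by linarith, by linarith⟩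

/-- On a subinterval of length `h` some value of `g` is a difference quotient of `f`, hence at most
`2P/h`; from there to `s`, `g` changes by at most `L h`. -/
theorem abs_le_of_hasDerivWithinAt_of_abs_le {a δ h s L P : ℝ} {f g g' : ℝ → ℝ}
    (hh : 0 < h) (hhδ : h ≤ δ / 2)
    (hf : ∀ x ∈ Icc a (a + δ), HasDerivWithinAt f (g x) (Icc a (a + δ)) x)
    (hg : ∀ x ∈ Icc a (a + δ), HasDerivWithinAt g (g' x) (Icc a (a + δ)) x)
    (hg' : ∀ x ∈ Icc a (a + δ), |g' x| ≤ L)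
    (hP : ∀ x ∈ Icc a (a + δ), |f x| ≤ P) (hs : s ∈ Icc a (a + δ)) :
    |g s| ≤ 2 * P / h + L * h := by
  obtain ⟨b, hb, hsb⟩ := exists_Icc_subset_of_mem_Icc hh hhδ hs
  have hL : 0 ≤ L := (abs_nonneg _).trans (hg' s hs)
  have hcont : ContinuousOn f (Icc b (b + h)) := fun x hx =>
    ((hf x (hb hx)).continuousWithinAt).mono hb
  obtain ⟨ξ, hξ, hξ'⟩ := exists_hasDerivAt_eq_slope f g (by linarith : b < b + h) hcont
    (fun x hx => ((hf x (hb (Ioo_subset_Icc_self hx))).mono hb).hasDerivAt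
      (Icc_mem_nhds hx.1 hx.2))
  have hξb := Ioo_subset_Icc_self hξ
  have h1 := (convex_Icc a (a + δ)).norm_image_sub_le_of_norm_hasDerivWithin_le hg hg'
    (hb hξb) hs
  have h2 : ‖s - ξ‖ ≤ h := by
    rw [Real.norm_eq_abs, abs_le]
    constructor <;> linarith [hsb.1, hsb.2, hξb.1, hξb.2]
  have h3 : |g s - g ξ| ≤ L * h := h1.trans (mul_le_mul_of_nonneg_left h2 hL)
  have h4 : |g ξ| ≤ 2 * P / h := by
    rw [hξ', add_sub_cancel_left, abs_div, abs_of_pos hh]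
    gcongr
    have := abs_sub (f (b + h)) (f b)
    linarith [hP b (hb ⟨le_rfl, by linarith⟩), hP (b + h) (hb ⟨by linarith, le_rfl⟩)]
  have h5 := abs_add_le (g ξ) (g s - g ξ)
  rw [add_sub_cancel] at h5
  linarith

/-- If `|f s|` were larger, `|f|` would stay above `c = |f s| - L h` on an interval of length `h`,
and `h c²` would exceed the integral of `f²`. -/
theorem abs_le_of_integral_sq {a δ h s L : ℝ} {f f' : ℝ → ℝ}
    (hh : 0 < h) (hhδ : h ≤ δ / 2)
    (hf : ∀ x ∈ Icc a (a + δ), HasDerivWithinAt f (f' x) (Icc a (a + δ)) x)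
    (hf' : ∀ x ∈ Icc a (a + δ), |f' x| ≤ L) (hs : s ∈ Icc a (a + δ)) :
    |f s| ≤ √(∫ x in a..a + δ, f x ^ 2) / √h + L * h := by
  obtain ⟨b, hb, hsb⟩ := exists_Icc_subset_of_mem_Icc hh hhδ hs
  have hL : 0 ≤ L := (abs_nonneg _).trans (hf' s hs)
  have hcont : ContinuousOn f (Icc a (a + δ)) := fun x hx => (hf x hx).continuousWithinAt
  by_contra! hlt
  set c := |f s| - L * h with hc
  have hc0 : √(∫ x in a..a + δ, f x ^ 2) / √h < c := by linarith
  have hcpos : 0 < c := lt_of_le_of_lt (by positivity) hc0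
  have hlow : ∀ x ∈ Icc b (b + h), c ^ 2 ≤ f x ^ 2 := by
    intro x hx
    have h1 := (convex_Icc a (a + δ)).norm_image_sub_le_of_norm_hasDerivWithin_le hf hf'
      (hb hx) hs
    have h2 : ‖s - x‖ ≤ h := by
      rw [Real.norm_eq_abs, abs_le]
      constructor <;> linarith [hsb.1, hsb.2, hx.1, hx.2]
    have h3 : |f s - f x| ≤ L * h := h1.trans (mul_le_mul_of_nonneg_left h2 hL)
    have h5 := abs_add_le (f x) (f s - f x)
    rw [add_sub_cancel] at h5
    rw [← sq_abs (f x)]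
    exact pow_le_pow_left₀ hcpos.le (by linarith) 2
  have hbm := hb ⟨le_rfl, by linarith⟩
  have hbm' := hb (⟨by linarith, le_rfl⟩ : b + h ∈ Icc b (b + h))
  have hsq : ContinuousOn (fun x => f x ^ 2) (Icc a (a + δ)) := hcont.pow 2
  have hI : ∫ x in b..b + h, f x ^ 2 ≤ ∫ x in a..a + δ, f x ^ 2 :=
    intervalIntegral.integral_mono_interval hbm.1 (by linarith) hbm'.2
      (Filter.Eventually.of_forall fun x => sq_nonneg (f x))
      (hsq.intervalIntegrable_of_Icc (by linarith [hs.1, hs.2]))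
  have hI2 : ∫ _ in b..b + h, c ^ 2 ≤ ∫ x in b..b + h, f x ^ 2 :=
    intervalIntegral.integral_mono_on (by linarith) (by simp)
      ((hsq.mono hb).intervalIntegrable_of_Icc (by linarith)) hlow
  rw [intervalIntegral.integral_const, add_sub_cancel_left, smul_eq_mul] at hI2
  rw [div_lt_iff₀ (Real.sqrt_pos.2 hh), Real.sqrt_lt' (by positivity), mul_pow,
    Real.sq_sqrt hh.le] at hc0
  linarith

/-- A Landau–Kolmogorov type interpolation estimate: the derivatives of a function are controlled
by its `L²` norm, up to an arbitrarily small multiple of the size of the highest derivative. -/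
theorem exists_abs_le_sqrt_integral_sq_add {ι : Type*} {m : ℕ} {δ : ℝ} (hδ : 0 < δ)
    {a N : ι → ℝ} {Y : ℕ → ι → ℝ → ℝ} (hN : ∀ i, 0 ≤ N i)
    (hY : ∀ k ≤ m, ∀ i, ∀ s ∈ Icc (a i) (a i + δ),
      HasDerivWithinAt (Y k i) (Y (k + 1) i s) (Icc (a i) (a i + δ)) s)
    (hb : ∀ k ≤ m + 1, ∃ K, ∀ i, ∀ s ∈ Icc (a i) (a i + δ), |Y k i s| ≤ K * N i) :
    ∀ k ≤ m, ∀ ε > 0, ∃ K ≥ 0, ∀ i, ∀ s ∈ Icc (a i) (a i + δ),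
      |Y k i s| ≤ K * √(∫ x in (a i)..(a i + δ), Y 0 i x ^ 2) + ε * N i := by
  intro k
  induction k with
  | zero =>
    intro _ ε hε
    obtain ⟨L, hL⟩ := hb 1 (by omega)
    -- Small enough that `L h ≤ ε`; the `+ 1` avoids division by zero.
    set h := min (δ / 2) (ε / (|L| + 1)) with hh
    have hpos : 0 < h := lt_min (by positivity) (by positivity)
    refine ⟨1 / √h, by positivity, fun i s hs => ?_⟩
    refine (abs_le_of_integral_sq hpos (min_le_left _ _) (hY 0 (by omega) i) (hL i) hs).trans ?_
    rw [one_div_mul_eq_div]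
    have h1 : h * (|L| + 1) ≤ ε := (le_div_iff₀ (by positivity)).1 (min_le_right _ _)
    have h2 : L * h ≤ ε := by nlinarith [le_abs_self L]
    have h3 : L * N i * h ≤ ε * N i := by nlinarith [hN i]
    linarith
  | succ k ih =>
    intro hk ε hε
    obtain ⟨L, hL⟩ := hb (k + 2) (by omega)
    set h := min (δ / 2) (ε / 2 / (|L| + 1)) with hh
    have hpos : 0 < h := lt_min (by positivity) (by positivity)
    -- The difference quotient multiplies this error by `2 / h`, giving `ε / 2`; the term `L h`
    -- supplies the other half.
    obtain ⟨K, hK, hKb⟩ := ih (by omega) (ε * h / 4) (by positivity)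
    refine ⟨2 * K / h, by positivity, fun i s hs => ?_⟩
    refine (abs_le_of_hasDerivWithinAt_of_abs_le hpos (min_le_left _ _) (hY k (by omega) i)
      (hY (k + 1) hk i) (hL i) (hKb i) hs).trans ?_
    have h1 : h * (|L| + 1) ≤ ε / 2 := (le_div_iff₀ (by positivity)).1 (min_le_right _ _)
    have h2 : L * h ≤ ε / 2 := by nlinarith [le_abs_self L]
    have h3 : L * N i * h ≤ ε / 2 * N i := by nlinarith [hN i]
    have h4 : 2 * (K * √(∫ x in (a i)..(a i + δ), Y 0 i x ^ 2) + ε * h / 4 * N i) / h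
        = 2 * K / h * √(∫ x in (a i)..(a i + δ), Y 0 i x ^ 2) + ε / 2 * N i := by
      field_simp
      ring
    rw [h4]
    linarith

/-! ### Bounded derivatives of the input and of the rows `r_i` -/

/-- `f` is `k` times differentiable on `[0, ∞)`, and bounded there together with its derivatives
up to order `k`. -/
def HasBoundedDerivs {E : Type*} [NormedAddCommGroup E] [NormedSpace ℝ E] :
    ℕ → (ℝ → E) → Prop
  | 0, f => ∃ M : ℝ, ∀ t, 0 ≤ t → ‖f t‖ ≤ M
  | k + 1, f => (∃ M : ℝ, ∀ t, 0 ≤ t → ‖f t‖ ≤ M) ∧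
      ∃ g : ℝ → E, (∀ t, 0 ≤ t → HasDerivWithinAt f (g t) (Ici 0) t) ∧ HasBoundedDerivs k g

namespace HasBoundedDerivs

variable {E F : Type*} [NormedAddCommGroup E] [NormedSpace ℝ E]
  [NormedAddCommGroup F] [NormedSpace ℝ F]

theorem bounded {k : ℕ} {f : ℝ → E} (h : HasBoundedDerivs k f) :
    ∃ M : ℝ, ∀ t, 0 ≤ t → ‖f t‖ ≤ M := by
  cases k with
  | zero => exact h
  | succ k => exact h.1

theorem of_succ {k : ℕ} {f : ℝ → E} (h : HasBoundedDerivs (k + 1) f) :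
    HasBoundedDerivs k f := by
  induction k generalizing f with
  | zero => exact h.1
  | succ k ih =>
    obtain ⟨hM, g, hg, hk⟩ := h
    exact ⟨hM, g, hg, ih hk⟩

theorem of_le {j k : ℕ} {f : ℝ → E} (h : HasBoundedDerivs k f) (hjk : j ≤ k) :
    HasBoundedDerivs j f := by
  induction hjk using Nat.decreasingInduction with
  | self => exact h
  | of_succ j hj ih => exact ih.of_succ

theorem congr {k : ℕ} {f g : ℝ → E} (h : HasBoundedDerivs k f) (hfg : EqOn g f (Ici 0)) :
    HasBoundedDerivs k g := by
  have hb : ∃ M : ℝ, ∀ t, 0 ≤ t → ‖g t‖ ≤ M := by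
    obtain ⟨M, hM⟩ := h.bounded
    exact ⟨M, fun t ht => by rw [hfg ht]; exact hM t ht⟩
  cases k with
  | zero => exact hb
  | succ k =>
    obtain ⟨_, f', hf', hk⟩ := h
    exact ⟨hb, f', fun t ht => (hf' t ht).congr hfg (hfg ht), hk⟩

theorem add {k : ℕ} {f g : ℝ → E} (hf : HasBoundedDerivs k f) (hg : HasBoundedDerivs k g) :
    HasBoundedDerivs k (fun t => f t + g t) := by
  induction k generalizing f g with
  | zero =>
    obtain ⟨M, hM⟩ := hf
    obtain ⟨M', hM'⟩ := hg
    exact ⟨M + M', fun t ht => (norm_add_le _ _).trans (add_le_add (hM t ht) (hM' t ht))⟩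
  | succ k ih =>
    obtain ⟨⟨M, hM⟩, f', hf', hfk⟩ := hf
    obtain ⟨⟨M', hM'⟩, g', hg', hgk⟩ := hg
    exact ⟨⟨M + M', fun t ht => (norm_add_le _ _).trans (add_le_add (hM t ht) (hM' t ht))⟩,
      fun t => f' t + g' t, fun t ht => (hf' t ht).add (hg' t ht), ih hfk hgk⟩

theorem clm_comp {k : ℕ} {f : ℝ → E} (hf : HasBoundedDerivs k f) (L : E →L[ℝ] F) :
    HasBoundedDerivs k (fun t => L (f t)) := by
  induction k generalizing f with
  | zero =>
    obtain ⟨M, hM⟩ := hf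
    exact ⟨‖L‖ * M, fun t ht => L.le_opNorm_of_le (hM t ht)⟩
  | succ k ih =>
    obtain ⟨⟨M, hM⟩, f', hf', hfk⟩ := hf
    exact ⟨⟨‖L‖ * M, fun t ht => L.le_opNorm_of_le (hM t ht)⟩, fun t => L (f' t),
      fun t ht => L.hasFDerivAt.comp_hasDerivWithinAt t (hf' t ht), ih hfk⟩

theorem zero (k : ℕ) : HasBoundedDerivs k (fun _ : ℝ => (0 : E)) := by
  induction k with
  | zero => exact ⟨0, fun t _ => by simp⟩
  | succ k ih => exact ⟨⟨0, fun t _ => by simp⟩, fun _ => 0, fun t _ => hasDerivWithinAt_const .., ih⟩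

theorem derivWithin {k : ℕ} {f : ℝ → E} (hf : HasBoundedDerivs (k + 1) f) :
    HasBoundedDerivs k (derivWithin f (Ici 0)) := by
  obtain ⟨_, g, hg, hk⟩ := hf
  exact hk.congr fun t ht => (hg t ht).derivWithin (uniqueDiffOn_Ici 0 t ht)

theorem hasDerivWithinAt {k : ℕ} {f : ℝ → E} (hf : HasBoundedDerivs (k + 1) f) {t : ℝ}
    (ht : 0 ≤ t) : HasDerivWithinAt f (_root_.derivWithin f (Ici 0) t) (Ici 0) t := by
  obtain ⟨_, g, hg, _⟩ := hf
  exact (hg t ht).differentiableWithinAt.hasDerivWithinAt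

theorem continuousOn {k : ℕ} {f : ℝ → E} (hf : HasBoundedDerivs (k + 1) f) :
    ContinuousOn f (Ici 0) :=
  fun _ ht => (hf.hasDerivWithinAt ht).continuousWithinAt

theorem of_iteratedDerivWithin {k : ℕ} {f : ℝ → E}
    (hd : ∀ j < k, DifferentiableOn ℝ (iteratedDerivWithin j f (Ici 0)) (Ici 0))
    (hb : ∀ j ≤ k, ∃ M : ℝ, ∀ t : ℝ, 0 ≤ t → ‖iteratedDerivWithin j f (Ici 0) t‖ ≤ M) :
    HasBoundedDerivs k f := by
  induction k generalizing f with
  | zero => simpa [HasBoundedDerivs] using hb 0 le_rfl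
  | succ k ih =>
    refine ⟨by simpa using hb 0 (Nat.zero_le _), _root_.derivWithin f (Ici 0), fun t ht => ?_,
      ih (fun j hj => ?_) (fun j hj => ?_)⟩
    · have := hd 0 (Nat.succ_pos k)
      rw [iteratedDerivWithin_zero] at this
      exact (this t ht).hasDerivWithinAt
    · exact (hd (j + 1) (by omega)).congr fun t ht => by rw [iteratedDerivWithin_succ']
    · obtain ⟨M, hM⟩ := hb (j + 1) (by omega)
      exact ⟨M, fun t ht => by rw [← iteratedDerivWithin_succ']; exact hM t ht⟩

end HasBoundedDerivs

theorem BoundedInput.hasBoundedDerivs {p κ : ℕ} {u : ℝ → Fin p → ℝ} (hu : BoundedInput κ u) :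
    HasBoundedDerivs κ u :=
  .of_iteratedDerivWithin hu.1 hu.2

theorem HasBoundedDerivs.vecMul {n p k : ℕ} {f : ℝ → Fin p → ℝ} (hf : HasBoundedDerivs k f)
    (M : Matrix (Fin p) (Fin n) ℝ) : HasBoundedDerivs k (fun t => f t ᵥ* M) :=
  hf.clm_comp (LinearMap.toContinuousLinearMap M.vecMulLinear)

/-- Each step of the recursion costs one derivative, but `r_i` involves `u` only up to order `i -
1`. Hence the budget `m + 1`: `r_m` is still differentiable and `r_{m+1}` still bounded. -/
theorem hasBoundedDerivs_rVec {n p m : ℕ} (A : Matrix (Fin n) (Fin n) ℝ)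
    (B : Matrix (Fin n) (Fin p) ℝ) (C : Matrix (Fin n) (Fin n) ℝ) {u : ℝ → Fin p → ℝ}
    (hu : HasBoundedDerivs m u) {i j : ℕ} (hij : i + j ≤ m + 1) :
    HasBoundedDerivs j (rVec A B C u i) := by
  induction i generalizing j with
  | zero => exact .zero j
  | succ i ih =>
    have h := ih (j := j + 1) (by omega)
    exact ((h.of_succ.vecMul A).add h.derivWithin).add ((hu.of_le (by omega)).vecMul _)

/-! ### Matrix exponentials and the block triangular transition matrix -/

open scoped Matrix.Norms.Operator in
theorem Matrix.hasDerivAt_exp_smul {ι : Type*} [Fintype ι] [DecidableEq ι] (A : Matrix ι ι ℝ)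
    (t : ℝ) : HasDerivAt (fun s : ℝ => NormedSpace.exp (s • A)) (A * NormedSpace.exp (t • A)) t :=
  hasDerivAt_exp_smul_const' A t

theorem Matrix.exp_smul_mul_exp_neg_smul {ι : Type*} [Fintype ι] [DecidableEq ι]
    (A : Matrix ι ι ℝ) (t : ℝ) :
    NormedSpace.exp (t • A) * NormedSpace.exp ((-t) • A) = 1 := by
  rw [← Matrix.exp_add_of_commute _ _ ((Commute.refl A).smul_left t |>.smul_right (-t)), neg_smul,
    add_neg_cancel, NormedSpace.exp_zero]

open scoped Matrix.Norms.Operator in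
theorem Matrix.continuous_exp_smul {ι : Type*} [Fintype ι] [DecidableEq ι] (A : Matrix ι ι ℝ) :
    Continuous (fun s : ℝ => NormedSpace.exp (s • A)) :=
  continuous_iff_continuousAt.2 fun t => (A.hasDerivAt_exp_smul t).continuousAt

open scoped Matrix.Norms.Operator in
theorem Matrix.hasDerivAt_exp_sub_smul_apply {ι : Type*} [Fintype ι] [DecidableEq ι]
    (A : Matrix ι ι ℝ) (τ t : ℝ) (i j : ι) :
    HasDerivAt (fun s : ℝ => NormedSpace.exp ((s - τ) • A) i j)
      ((A * NormedSpace.exp ((t - τ) • A)) i j) t := by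
  have h := (A.hasDerivAt_exp_smul (t - τ)).comp_sub_const t τ
  exact (LinearMap.toContinuousLinearMap (Matrix.entryLinearMap ℝ ℝ i j)).hasFDerivAt.comp_hasDerivAt t h

open scoped Matrix.Norms.Operator in
/-- Variation of constants: the off-diagonal block of the transition matrix of a block triangular
system with constant diagonal blocks. -/
theorem exists_hasDerivAt_variation_of_constants {ι κ : Type*} [Fintype ι] [DecidableEq ι]
    [Fintype κ] [DecidableEq κ] (S : Matrix ι ι ℝ) (A : Matrix κ κ ℝ)
    {U : ℝ → Matrix ι κ ℝ} (hU : Continuous U) (τ : ℝ) :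
    ∃ X : ℝ → Matrix ι κ ℝ, X τ = 0 ∧ ∀ t, ∀ i j, HasDerivAt (fun s => X s i j)
      ((S * X t + U t * NormedSpace.exp ((t - τ) • A)) i j) t := by
  -- Splitting `exp ((t - s) S)` as `exp (t S) exp (-s S)` makes the integrand independent of `t`,
  -- so the product rule applies.
  set F : ℝ → Matrix ι κ ℝ := fun s =>
    NormedSpace.exp ((-s) • S) * U s * NormedSpace.exp ((s - τ) • A) with hF
  have hFc : Continuous F :=
    ((S.continuous_exp_smul.comp continuous_neg).matrix_mul hU).matrix_mul
      (A.continuous_exp_smul.comp (continuous_id.sub continuous_const))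
  refine ⟨fun t => NormedSpace.exp (t • S) * matrixIntegral F τ t, ?_, fun t i j => ?_⟩
  · have : matrixIntegral F τ τ = 0 := by
      ext
      simp [matrixIntegral]
    simp [this]
  have hint : ∀ k, HasDerivAt (fun s => matrixIntegral F τ s k j) (F t k j) t := fun k =>
    have hc := hFc.matrix_elem k j
    intervalIntegral.integral_hasDerivAt_right (hc.intervalIntegrable _ _)
      hc.stronglyMeasurable.stronglyMeasurableAtFilter hc.continuousAt
  have hexp : ∀ k, HasDerivAt (fun s : ℝ => NormedSpace.exp (s • S) i k)
      ((S * NormedSpace.exp (t • S)) i k) t := fun k =>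
    (LinearMap.toContinuousLinearMap (Matrix.entryLinearMap ℝ ℝ i k)).hasFDerivAt.comp_hasDerivAt t
      (S.hasDerivAt_exp_smul t)
  have h := HasDerivAt.fun_sum (u := Finset.univ) fun k _ => (hexp k).mul (hint k)
  have e : NormedSpace.exp (t • S) * F t = U t * NormedSpace.exp ((t - τ) • A) := by
    rw [hF, ← Matrix.mul_assoc, ← Matrix.mul_assoc, Matrix.exp_smul_mul_exp_neg_smul,
      Matrix.one_mul]
  rw [← e, ← Matrix.mul_assoc]
  simp only [Matrix.add_apply]
  rw [Matrix.mul_apply, Matrix.mul_apply (M := NormedSpace.exp (t • S)), ← Finset.sum_add_distrib]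
  exact h

theorem exists_isTransitionMatrix_fromBlocks {ι κ : Type*} [Fintype ι] [DecidableEq ι]
    [Fintype κ] [DecidableEq κ] (S : Matrix ι ι ℝ) (A : Matrix κ κ ℝ)
    {U : ℝ → Matrix ι κ ℝ} (hU : ContinuousOn U (Ici 0)) :
    ∃ Φ, IsTransitionMatrix (fun t => fromBlocks S (U t) 0 A) Φ ∧
      ∀ t τ, (Φ t τ).toBlocks₂₁ = 0 ∧ (Φ t τ).toBlocks₂₂ = NormedSpace.exp ((t - τ) • A) := by
  -- Freezing `U` at its value at `0` for negative times gives continuity on the whole line without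
  -- changing the equation on `[0, ∞)`.
  have hU' : Continuous fun t => U (max t 0) :=
    hU.comp_continuous (continuous_id.max continuous_const) fun t => le_max_right t 0
  choose X hX0 hX using exists_hasDerivAt_variation_of_constants S A hU'
  refine ⟨fun t τ => fromBlocks (NormedSpace.exp ((t - τ) • S)) (X τ t) 0
    (NormedSpace.exp ((t - τ) • A)), fun τ _ => ⟨?_, fun t ht i j => ?_⟩, fun t τ => by simp⟩
  · simp [hX0, NormedSpace.exp_zero]
  · rw [fromBlocks_multiply]
    rcases i with i | i <;> rcases j with j | j
    · simpa using (S.hasDerivAt_exp_sub_smul_apply τ t i j).hasDerivWithinAt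
    · have := (hX τ t i j).hasDerivWithinAt (s := Ici 0)
      rw [max_eq_left ht] at this
      simpa using this
    · simpa using hasDerivWithinAt_const t (Ici (0 : ℝ)) (0 : ℝ)
    · simpa using (A.hasDerivAt_exp_sub_smul_apply τ t i j).hasDerivWithinAt

/-! ### Sup norm estimates and quadratic forms of matrix integrals -/

theorem abs_dotProduct_le_card_mul_norm {ι : Type*} [Fintype ι] (v w : ι → ℝ) :
    |v ⬝ᵥ w| ≤ Fintype.card ι * (‖v‖ * ‖w‖) := by
  refine (Finset.abs_sum_le_sum_abs _ _).trans ?_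
  have h : ∀ i ∈ Finset.univ, |v i * w i| ≤ ‖v‖ * ‖w‖ := fun i _ => by
    rw [abs_mul]
    exact mul_le_mul (norm_le_pi_norm v i) (norm_le_pi_norm w i) (abs_nonneg _) (norm_nonneg _)
  simpa using Finset.sum_le_card_nsmul _ _ _ h

theorem norm_sq_le_dotProduct_self {ι : Type*} [Fintype ι] (v : ι → ℝ) : ‖v‖ ^ 2 ≤ v ⬝ᵥ v := by
  have h0 : 0 ≤ v ⬝ᵥ v := Finset.sum_nonneg fun i _ => mul_self_nonneg (v i)
  rw [← Real.le_sqrt (norm_nonneg v) h0, pi_norm_le_iff_of_nonneg (Real.sqrt_nonneg _)]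
  intro i
  refine Real.le_sqrt_of_sq_le ?_
  rw [Real.norm_eq_abs, sq_abs, sq]
  exact Finset.single_le_sum (f := fun i => v i * v i) (fun i _ => mul_self_nonneg (v i))
    (Finset.mem_univ i)

theorem norm_comp_le_norm {ι κ : Type*} [Fintype ι] [Fintype κ] (v : ι → ℝ) (f : κ → ι) :
    ‖v ∘ f‖ ≤ ‖v‖ :=
  (pi_norm_le_iff_of_nonneg (norm_nonneg v)).2 fun k => norm_le_pi_norm v (f k)

theorem dotProduct_matrixIntegral_mulVec {ι κ : Type*} [Fintype ι] [Fintype κ]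
    {F : ℝ → Matrix ι κ ℝ} {a b : ℝ}
    (hF : ∀ i j, IntervalIntegrable (fun s => F s i j) MeasureTheory.volume a b)
    (v : ι → ℝ) (w : κ → ℝ) :
    v ⬝ᵥ (matrixIntegral F a b *ᵥ w) = ∫ s in a..b, v ⬝ᵥ (F s *ᵥ w) := by
  simp only [dotProduct, mulVec, matrixIntegral, Matrix.of_apply]
  rw [intervalIntegral.integral_finsetSum]
  · refine Finset.sum_congr rfl fun i _ => ?_
    rw [intervalIntegral.integral_const_mul, intervalIntegral.integral_finsetSum]
    · simp_rw [intervalIntegral.integral_mul_const]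
    · exact fun j _ => (hF i j).mul_const _
  · intro i _
    refine IntervalIntegrable.const_mul ?_ _
    have := IntervalIntegrable.sum Finset.univ (f := fun j s => F s i j * w j)
      fun j _ => (hF i j).mul_const (w j)
    simpa [Finset.sum_fn] using this

theorem isHermitian_matrixIntegral {ι : Type*} {F : ℝ → Matrix ι ι ℝ} {a b : ℝ}
    (hF : ∀ s, (F s)ᵀ = F s) : (matrixIntegral F a b).IsHermitian := by
  ext i j
  simp only [matrixIntegral, conjTranspose_apply, of_apply, star_trivial]
  congr 1
  ext s
  exact congrFun (congrFun (hF s) i) j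

theorem dotProduct_transpose_mul_mul_mulVec {ι κ : Type*} [Fintype ι] [Fintype κ]
    (M : Matrix κ ι ℝ) (r : κ → ℝ) (v : ι → ℝ) :
    v ⬝ᵥ ((Mᵀ * vecMulVec r r * M) *ᵥ v) = (r ⬝ᵥ (M *ᵥ v)) ^ 2 := by
  rw [← mulVec_mulVec, ← mulVec_mulVec, dotProduct_mulVec, vecMul_transpose, vecMulVec_mulVec,
    dotProduct_smul, sq, dotProduct_comm (M *ᵥ v) r]
  simp

/-! ### The chain of output derivatives -/

/-- The `k`-th derivative of the output of the augmented system along the trajectory `Z`. -/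
noncomputable def outputDeriv {n p : ℕ} (m : ℕ) (A : Matrix (Fin n) (Fin n) ℝ)
    (B : Matrix (Fin n) (Fin p) ℝ) (C : Matrix (Fin n) (Fin n) ℝ) (u : ℝ → Fin p → ℝ)
    (Z : ℝ → Fin m ⊕ Fin n → ℝ) (k : ℕ) (s : ℝ) : ℝ :=
  (if h : k < m then Z s (.inl ⟨k, h⟩) else 0) + rVec A B C u k s ⬝ᵥ (Z s ∘ Sum.inr)

/-- The term `uᵀ Bᵀ C_k x` from `z_k'` and the terms `(r_k' + r_k A) x` from the product rule add up
to `r_{k+1} x`. -/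
theorem hasDerivWithinAt_outputDeriv {n p m : ℕ} {A : Matrix (Fin n) (Fin n) ℝ}
    {B : Matrix (Fin n) (Fin p) ℝ} {C : Matrix (Fin n) (Fin n) ℝ} (hm : lieMatrix A C m = 0)
    {u : ℝ → Fin p → ℝ} (hu : HasBoundedDerivs m u) {Z : ℝ → Fin m ⊕ Fin n → ℝ} {s : ℝ}
    (hs : 0 ≤ s)
    (hZ : ∀ l, HasDerivWithinAt (fun s => Z s l) ((augmentedA m A B C (u s) *ᵥ Z s) l) (Ici 0) s)
    {k : ℕ} (hk : k ≤ m) :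
    HasDerivWithinAt (outputDeriv m A B C u Z k) (outputDeriv m A B C u Z (k + 1) s) (Ici 0) s := by
  have hx : ∀ j, HasDerivWithinAt (fun s => Z s (.inr j)) ((A *ᵥ (Z s ∘ Sum.inr)) j)
      (Ici 0) s := fun j => by
    simpa [augmentedA, fromBlocks_mulVec] using hZ (.inr j)
  have hr : ∀ j, HasDerivWithinAt (fun s => rVec A B C u k s j)
      (derivWithin (rVec A B C u k) (Ici 0) s j) (Ici 0) s :=
    hasDerivWithinAt_pi.1
      ((hasBoundedDerivs_rVec A B C hu (i := k) (j := 1) (by omega)).hasDerivWithinAt hs)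
  have hrx := HasDerivWithinAt.fun_sum (u := Finset.univ) fun j _ => (hr j).mul (hx j)
  have hz : HasDerivWithinAt (fun s => if h : k < m then Z s (.inl ⟨k, h⟩) else 0)
      ((if h : k + 1 < m then Z s (.inl ⟨k + 1, h⟩) else 0)
        + (u s ᵥ* (Bᵀ * lieMatrix A C k)) ⬝ᵥ (Z s ∘ Sum.inr)) (Ici 0) s := by
    by_cases h : k < m
    · simp only [dif_pos h]
      convert hZ (.inl ⟨k, h⟩) using 1
      simp only [augmentedA, fromBlocks_mulVec, Sum.elim_inl, Pi.add_apply]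
      congr 1
      simp only [mulVec, dotProduct, shiftMatrix, of_apply, ite_mul, one_mul, zero_mul]
      split_ifs with h1
      · rw [Finset.sum_eq_single ⟨k + 1, h1⟩] <;> simp +contextual [Fin.ext_iff, eq_comm]
      · exact (Finset.sum_eq_zero fun j _ => if_neg (by have := j.2; omega)).symm
    -- There is no `z_m` to supply the term `uᵀ Bᵀ C_m x`, but it vanishes because `C_m = 0`.
    · obtain rfl : k = m := by omega
      simpa [hm] using hasDerivWithinAt_const s (Ici (0 : ℝ)) (0 : ℝ)
  refine (hz.add hrx).congr_deriv ?_
  have e : rVec A B C u (k + 1) s = rVec A B C u k s ᵥ* A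
    + derivWithin (rVec A B C u k) (Ici 0) s + u s ᵥ* (Bᵀ * lieMatrix A C k) := rfl
  rw [outputDeriv, e, add_dotProduct, add_dotProduct, ← dotProduct_mulVec (rVec A B C u k s),
    Finset.sum_add_distrib]
  change _ + _ + (derivWithin (rVec A B C u k) (Ici 0) s ⬝ᵥ (Z s ∘ Sum.inr)
    + rVec A B C u k s ⬝ᵥ (A *ᵥ (Z s ∘ Sum.inr))) = _
  ring

theorem augmentedC_mulVec {n p m : ℕ} (A : Matrix (Fin n) (Fin n) ℝ)
    (B : Matrix (Fin n) (Fin p) ℝ) (C : Matrix (Fin n) (Fin n) ℝ) (u : ℝ → Fin p → ℝ)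
    (Z : ℝ → Fin m ⊕ Fin n → ℝ) (s : ℝ) (i : Fin 1) :
    (augmentedC m n *ᵥ Z s) i = outputDeriv m A B C u Z 0 s := by
  simp only [augmentedC, outputDeriv, rVec, mulVec, dotProduct, of_apply, Fintype.sum_sum_type,
    Sum.elim_inl, Sum.elim_inr, zero_mul, Pi.zero_apply, Finset.sum_const_zero, add_zero, ite_mul,
    one_mul]
  split_ifs with h
  · rw [Finset.sum_eq_single ⟨0, h⟩] <;> simp +contextual [Fin.ext_iff]
  · obtain rfl : m = 0 := by omega
    simp

theorem continuousOn_inputBlock {n p m : ℕ} (A : Matrix (Fin n) (Fin n) ℝ)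
    (B : Matrix (Fin n) (Fin p) ℝ) (C : Matrix (Fin n) (Fin n) ℝ) {u : ℝ → Fin p → ℝ}
    (hu : HasBoundedDerivs m u) :
    ContinuousOn (fun t => inputBlock m A B C (u t)) (Ici 0) := by
  cases m with
  -- For `m = 0` the input need not be continuous, but the block has no rows.
  | zero => exact (continuous_of_const fun _ _ => by ext i; exact i.elim0).continuousOn
  | succ m =>
    refine continuousOn_pi.2 fun i => ?_
    exact (hu.vecMul _).continuousOn

open scoped Matrix.Norms.Operator in
theorem exists_norm_exp_smul_mulVec_le {ι : Type*} [Fintype ι] [DecidableEq ι] (A : Matrix ι ι ℝ)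
    (δ : ℝ) : ∃ K, ∀ r ∈ Icc 0 δ, ∀ v : ι → ℝ, ‖NormedSpace.exp (r • A) *ᵥ v‖ ≤ K * ‖v‖ := by
  obtain ⟨K, hK⟩ := isCompact_Icc.exists_bound_of_continuousOn
    (A.continuous_exp_smul.continuousOn (s := Icc 0 δ))
  exact ⟨K, fun r hr v => (Matrix.linfty_opNorm_mulVec _ _).trans
    (mul_le_mul_of_nonneg_right (hK r hr) (norm_nonneg v))⟩

theorem exists_forall_le_of_forall_exists {P : ℕ → ℝ → Prop} (m : ℕ)
    (hP : ∀ k x y, x ≤ y → P k x → P k y) (h : ∀ k ≤ m, ∃ x ≥ 0, P k x) :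
    ∃ x ≥ 0, ∀ k ≤ m, P k x := by
  choose! f hf0 hf using h
  refine ⟨∑ k ∈ Finset.range (m + 1), f k, Finset.sum_nonneg fun k hk => hf0 k ?_, fun k hk => ?_⟩
  · have := Finset.mem_range.1 hk
    omega
  · refine hP k (f k) _ (Finset.single_le_sum (f := f) (fun j hj => hf0 j ?_) ?_) (hf k hk)
    · have := Finset.mem_range.1 hj
      omega
    · exact Finset.mem_range.2 (by omega)

/-! ### Uniform observability -/

theorem proposition3 {n p : ℕ}
    (A : Matrix (Fin n) (Fin n) ℝ) (B : Matrix (Fin n) (Fin p) ℝ)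
    (C : Matrix (Fin n) (Fin n) ℝ) (hC : C.IsSymm)
    (m : ℕ) (hm : lieMatrix A C m = 0)
    (u : ℝ → Fin p → ℝ) (hu : BoundedInput m u)
    (hPE : PersistentlyExciting A (rVec A B C u m)) :
    UniformlyObservable (fun t => augmentedA m A B C (u t)) (fun _ => augmentedC m n) := by
  have hud := hu.hasBoundedDerivs
  obtain ⟨Φ, hΦ, hΦb⟩ := exists_isTransitionMatrix_fromBlocks (shiftMatrix m) A
    (continuousOn_inputBlock (m := m) A B C hud)
  obtain ⟨δ, hδ, μ, hμ, hPE⟩ := hPE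
  refine ⟨Φ, hΦ, δ, hδ, ?_⟩
  -- Indexing by initial time and initial state makes every constant below uniform in both.
  let I := {t : ℝ // 0 ≤ t} × (Fin m ⊕ Fin n → ℝ)
  let Z : I → ℝ → Fin m ⊕ Fin n → ℝ := fun i s => Φ s i.1 *ᵥ i.2
  let a : I → ℝ := fun i => i.1
  let N : I → ℝ := fun i => ‖i.2‖
  let Y : ℕ → I → ℝ → ℝ := fun k i => outputDeriv m A B C u (Z i) k
  have ha : ∀ i, 0 ≤ a i := fun i => i.1.2
  have hN : ∀ i, 0 ≤ N i := fun i => norm_nonneg _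
  have hsub : ∀ i, Icc (a i) (a i + δ) ⊆ Ici 0 := fun i s hs => (ha i).trans hs.1
  have hZa : ∀ i, Z i (a i) = i.2 := fun i => by
    simp only [Z, a, (hΦ _ (ha i)).1, one_mulVec]
  have hZx : ∀ i s, Z i s ∘ Sum.inr = NormedSpace.exp ((s - a i) • A) *ᵥ (i.2 ∘ Sum.inr) := by
    intro i s
    obtain ⟨h1, h2⟩ := hΦb s (a i)
    change (Φ s (a i) *ᵥ i.2) ∘ Sum.inr = _
    rw [← fromBlocks_toBlocks (Φ s (a i)), h1, h2, fromBlocks_mulVec, Sum.elim_comp_inr,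
      zero_mulVec, zero_add]
  have hZ : ∀ i s, 0 ≤ s → ∀ l, HasDerivWithinAt (fun s => Z i s l)
      ((augmentedA m A B C (u s) *ᵥ Z i s) l) (Ici 0) s := by
    intro i s hs l
    have h := HasDerivWithinAt.fun_sum (u := Finset.univ) fun j _ =>
      ((hΦ _ (ha i)).2 s hs l j).mul_const (i.2 j)
    refine h.congr_deriv ?_
    rw [mulVec_mulVec]
    rfl
  have hYd : ∀ k ≤ m, ∀ i, ∀ s, 0 ≤ s → HasDerivWithinAt (Y k i) (Y (k + 1) i s) (Ici 0) s :=
    fun k hk i s hs => hasDerivWithinAt_outputDeriv hm hud hs (hZ i s hs) hk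
  have hY : ∀ k ≤ m, ∀ i, ∀ s ∈ Icc (a i) (a i + δ),
      HasDerivWithinAt (Y k i) (Y (k + 1) i s) (Icc (a i) (a i + δ)) s :=
    fun k hk i s hs => (hYd k hk i s (hsub i hs)).mono (hsub i)
  have hx0 : ∀ i : I, ‖i.2 ∘ Sum.inr‖ ≤ N i := fun i => norm_comp_le_norm _ _
  obtain ⟨R, hR0, hR⟩ : ∃ R ≥ 0, ∀ k ≤ m + 1, ∀ t, 0 ≤ t → ‖rVec A B C u k t‖ ≤ R := by
    refine exists_forall_le_of_forall_exists (m + 1)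
      (fun k x y hxy h t ht => (h t ht).trans hxy) fun k hk => ?_
    obtain ⟨M, hM⟩ := (hasBoundedDerivs_rVec (j := 0) A B C hud hk).bounded
    exact ⟨|M|, abs_nonneg M, fun t ht => (hM t ht).trans (le_abs_self M)⟩
  have hrw : ∀ k ≤ m + 1, ∀ t, 0 ≤ t → ∀ w : Fin n → ℝ,
      |rVec A B C u k t ⬝ᵥ w| ≤ n * R * ‖w‖ := by
    intro k hk t ht w
    refine (abs_dotProduct_le_card_mul_norm _ _).trans ?_
    rw [Fintype.card_fin, mul_assoc]
    have := hR k hk t ht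
    gcongr
  have hYm : ∀ k, m ≤ k → ∀ i s, Y k i s = rVec A B C u k s ⬝ᵥ (Z i s ∘ Sum.inr) := by
    intro k hk i s
    simp only [Y, outputDeriv]
    rw [dif_neg (by omega), zero_add]
  have h0 : ∀ k ≤ m, ∃ K, ∀ i, |Y k i (a i)| ≤ K * N i := by
    intro k hk
    refine ⟨1 + n * R, fun i => ?_⟩
    simp only [Y, outputDeriv, hZa]
    refine (abs_add_le _ _).trans ?_
    rw [add_mul]
    refine add_le_add ?_ ((hrw k (by omega) _ (ha i) _).trans
      (mul_le_mul_of_nonneg_left (hx0 i) (by positivity)))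
    rw [one_mul]
    split_ifs
    · exact norm_le_pi_norm i.2 _
    · simpa using hN i
  -- `x` evolves by `exp (A (s - t))` alone, so its growth over the window depends only on `δ`.
  have htop : ∃ K, ∀ i, ∀ s ∈ Icc (a i) (a i + δ), |Y (m + 1) i s| ≤ K * N i := by
    obtain ⟨E, hE⟩ := exists_norm_exp_smul_mulVec_le A δ
    refine ⟨n * R * |E|, fun i s hs => ?_⟩
    rw [hYm (m + 1) (by omega) i s, hZx]
    refine (hrw (m + 1) le_rfl s (hsub i hs) _).trans ?_
    rw [mul_assoc _ |E|]
    gcongr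
    refine (hE (s - a i) ⟨by linarith [hs.1], by linarith [hs.2]⟩ _).trans ?_
    have := hx0 i
    gcongr
    exact le_abs_self E
  have hint := exists_abs_le_sqrt_integral_sq_add hδ hN hY
    (exists_bound_of_hasDerivWithinAt_chain hδ.le hN hY h0 htop)
  have hYc : ∀ i, ∀ k ≤ m, ContinuousOn (Y k i) (Icc (a i) (a i + δ)) :=
    fun i k hk s hs => (hY k hk i s hs).continuousWithinAt
  -- Persistent excitation applied to the initial `x` gives `μ |x|² ≤ ∫ Y_m² ≤ δ P²`.
  have hxnorm : ∀ i P, 0 ≤ P → (∀ s ∈ Icc (a i) (a i + δ), |Y m i s| ≤ P) →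
      ‖i.2 ∘ Sum.inr‖ ≤ √(δ / μ) * P := by
    intro i P hP hle
    have hpsd := (hPE (a i) (ha i)).dotProduct_mulVec_nonneg (i.2 ∘ Sum.inr)
    rw [star_trivial, sub_mulVec, smul_mulVec, one_mulVec, dotProduct_sub, dotProduct_smul,
      dotProduct_matrixIntegral_mulVec ?_] at hpsd
    · simp_rw [dotProduct_transpose_mul_mul_mulVec, ← hZx, ← hYm m le_rfl] at hpsd
      have h1 : ∫ s in (a i)..(a i + δ), Y m i s ^ 2 ≤ ∫ _ in (a i)..(a i + δ), P ^ 2 := by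
        refine intervalIntegral.integral_mono_on (by linarith)
          (((hYc i m le_rfl).pow 2).intervalIntegrable_of_Icc (by linarith)) (by simp)
          fun s hs => ?_
        rw [← sq_abs]
        exact pow_le_pow_left₀ (abs_nonneg _) (hle s hs) 2
      rw [intervalIntegral.integral_const, add_sub_cancel_left, smul_eq_mul] at h1
      have h2 := norm_sq_le_dotProduct_self (i.2 ∘ Sum.inr)
      rw [smul_eq_mul] at hpsd
      refine le_of_sq_le_sq ?_ (by positivity)
      rw [mul_pow, Real.sq_sqrt (by positivity), div_mul_eq_mul_div, le_div_iff₀ hμ]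
      nlinarith
    · intro k l
      refine ContinuousOn.intervalIntegrable_of_Icc (by linarith) ?_
      have hr : ContinuousOn (rVec A B C u m) (Icc (a i) (a i + δ)) :=
        (hasBoundedDerivs_rVec A B C hud (i := m) (j := 1) le_rfl).continuousOn.mono (hsub i)
      have he : Continuous fun s : ℝ => NormedSpace.exp ((s - a i) • A) :=
        A.continuous_exp_smul.comp (continuous_id.sub continuous_const)
      have hv : ContinuousOn (fun s => vecMulVec (rVec A B C u m s) (rVec A B C u m s))
          (Icc (a i) (a i + δ)) :=
        continuousOn_pi.2 fun x => continuousOn_pi.2 fun y =>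
          (continuousOn_pi.1 hr x).mul (continuousOn_pi.1 hr y)
      have hF := (by fun_prop : Continuous fun M : Matrix (Fin n) (Fin n) ℝ ×
        Matrix (Fin n) (Fin n) ℝ => M.1ᵀ * M.2 * M.1).comp_continuousOn (he.continuousOn.prodMk hv)
      exact continuousOn_pi.1 (continuousOn_pi.1 hF k) l
  have hNle : ∀ i P, 0 ≤ P → (∀ k ≤ m, ∀ s ∈ Icc (a i) (a i + δ), |Y k i s| ≤ P) →
      N i ≤ (1 + (1 + n * R) * √(δ / μ)) * P := by
    intro i P hP hle
    have hx := hxnorm i P hP (hle m le_rfl)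
    have hq : 0 ≤ √(δ / μ) * P := by positivity
    have hnR : 0 ≤ n * R := by positivity
    refine (pi_norm_le_iff_of_nonneg (by positivity)).2 ?_
    rintro (k | j)
    · have hk := hle k k.2.le (a i) ⟨le_rfl, by linarith⟩
      have hk2 := hrw k (by have := k.2; omega) (a i) (ha i) (i.2 ∘ Sum.inr)
      have e : i.2 (.inl k) = Y k i (a i) - rVec A B C u k (a i) ⬝ᵥ (i.2 ∘ Sum.inr) := by
        simp only [Y, outputDeriv, hZa]
        rw [dif_pos k.2, add_sub_cancel_right]
      rw [e, Real.norm_eq_abs]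
      refine (abs_sub _ _).trans ?_
      nlinarith [mul_le_mul_of_nonneg_left hx hnR]
    · have := norm_le_pi_norm (i.2 ∘ Sum.inr) j
      simp only [Function.comp_apply] at this
      nlinarith [mul_nonneg hnR hq]
  set D := 1 + (1 + n * R) * √(δ / μ) with hD
  have hDpos : 0 < D := by positivity
  -- With `ε = 1 / (2 D)`, the bound `hNle` turns the error into `N i / 2`, which moves to the left
  -- side.
  obtain ⟨K, hK0, hK⟩ : ∃ K ≥ 0, ∀ k ≤ m, ∀ i, ∀ s ∈ Icc (a i) (a i + δ),
      |Y k i s| ≤ K * √(∫ x in (a i)..(a i + δ), Y 0 i x ^ 2) + 1 / (2 * D) * N i :=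
    exists_forall_le_of_forall_exists m
      (fun k x y hxy h i s hs => (h i s hs).trans (by gcongr))
      fun k hk => hint k hk (1 / (2 * D)) (by positivity)
  have hmain : ∀ i, N i ≤ 2 * D * K * √(∫ x in (a i)..(a i + δ), Y 0 i x ^ 2) := by
    intro i
    have h := hNle i _ (by have := hN i; positivity) fun k hk => hK k hk i
    have e : D * (1 / (2 * D) * N i) = N i / 2 := by field_simp
    rw [mul_add, e] at h
    linarith
  -- The factor `m + n` passes from the sup norm to `v ⬝ᵥ v`; the `+ 1` keeps the denominator
  -- positive.
  refine ⟨1 / ((m + n) * (2 * D * K) ^ 2 + 1), by positivity, fun t ht => ?_⟩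
  have hF : ∀ s, (Φ s t)ᵀ * (augmentedC m n)ᵀ * augmentedC m n * Φ s t
      = (augmentedC m n * Φ s t)ᵀ * (augmentedC m n * Φ s t) := fun s => by
    simp only [transpose_mul, Matrix.mul_assoc]
  refine .of_dotProduct_mulVec_nonneg (.sub (isHermitian_matrixIntegral fun s => ?_) ?_) fun v => ?_
  · rw [hF, transpose_mul, transpose_transpose]
  · exact isHermitian_one.smul (star_trivial _)
  let i : I := (⟨t, ht⟩, v)
  rw [star_trivial, sub_mulVec, smul_mulVec, one_mulVec, dotProduct_sub, dotProduct_smul,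
    observabilityGramian, dotProduct_matrixIntegral_mulVec ?_]
  · have hq : ∀ s, v ⬝ᵥ (((Φ s t)ᵀ * (augmentedC m n)ᵀ * augmentedC m n * Φ s t) *ᵥ v)
        = Y 0 i s ^ 2 := fun s => by
      rw [hF, ← mulVec_mulVec, dotProduct_mulVec, vecMul_transpose, ← mulVec_mulVec, dotProduct,
        Fin.sum_univ_one, augmentedC_mulVec A B C u (Z i), sq]
    simp_rw [hq]
    have h1 : v ⬝ᵥ v ≤ (m + n) * N i ^ 2 := by
      have := (le_abs_self _).trans (abs_dotProduct_le_card_mul_norm v v)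
      simpa [sq] using this
    have hJ : 0 ≤ ∫ x in t..t + δ, Y 0 i x ^ 2 :=
      intervalIntegral.integral_nonneg (by linarith) fun x _ => sq_nonneg _
    have h2 : N i ^ 2 ≤ (2 * D * K) ^ 2 * ∫ x in t..t + δ, Y 0 i x ^ 2 := by
      have := pow_le_pow_left₀ (hN i) (hmain i) 2
      rwa [mul_pow, Real.sq_sqrt hJ] at this
    rw [smul_eq_mul, sub_nonneg, one_div_mul_eq_div, div_le_iff₀ (by positivity)]
    have h3 := mul_le_mul_of_nonneg_left h2 (by positivity : (0 : ℝ) ≤ m + n)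
    linarith
  · intro k l
    refine ContinuousOn.intervalIntegrable_of_Icc (by linarith) ?_
    have hΦc : ContinuousOn (fun s => Φ s t) (Icc t (t + δ)) :=
      continuousOn_pi.2 fun x => continuousOn_pi.2 fun y s hs =>
        (((hΦ t ht).2 s (ht.trans hs.1) x y).continuousWithinAt).mono fun r hr => ht.trans hr.1
    have hc : ContinuousOn (fun s => (augmentedC m n * Φ s t)ᵀ * (augmentedC m n * Φ s t))
        (Icc t (t + δ)) :=
      (by fun_prop : Continuous fun M : Matrix (Fin m ⊕ Fin n) (Fin m ⊕ Fin n) ℝ =>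
        (augmentedC m n * M)ᵀ * (augmentedC m n * M)).comp_continuousOn hΦc
    simp_rw [hF]
    exact continuousOn_pi.1 (continuousOn_pi.1 hc k) l
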